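/- **Theorem 2.5.** A word over an alphabet $\mathcal A$ is *square-free* if it has no factor of the form $XX$ with $X$ nonempty. For $0\le i\le n$, an *extension* at position $i$ of a word $W$ of length $n$ is a word $P\,\mathtt{x}\,S$, where $W=PS$, $P$ has length $i$, and $\mathtt{x}\in\mathcal A$. A square-free word is *bifurcate* over $\mathcal A$ if it has at least one square-free extension at every position. A *bifurcate tree* over $\mathcal A$ is a rooted tree whose vertices are labelled with (not necessarily distinct) bifurcate words over $\mathcal A$ such that the labels of the children of any vertex $v$ are extensions of the label of $v$ at pairwise different positions; it is *complete* if every vertex labelled with a word of length $n$ has the maximum possible number $n+1$ of children. Let $\mathcal A$ be an alphabet with exactly $12$ letters, and let $\mathtt a\in\mathcal A$. Then there is a complete bifurcate tree over $\mathcal A$ whose root is labelled with the one-letter word $\mathtt a$. In this tree, every vertex labelled with a word of length $n$ has, for each position $i\in\{0,1,\dots,n\}$, exactly one child whose label is an extension of its label at position $i$. -/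

import Mathlib

namespace BifurcateWords

/-- A word is square-free if it has no factor of the form `X ++ X` with `X` nonempty. -/
def SquareFree {A : Type*} (W : List A) : Prop :=
  ∀ X : List A, X ≠ [] → ¬ (X ++ X) <:+: W

/-- `U` is an extension of `W` at position `i`, where `0 ≤ i ≤ |W|`: the word `U` is obtained from
`W` by inserting one letter `x` between the prefix of length `i` and the rest of `W`. -/
def IsExtensionAt {A : Type*} (W : List A) (i : ℕ) (U : List A) : Prop :=
  i ≤ W.length ∧ ∃ x : A, U = W.take i ++ x :: W.drop i

/-- A square-free word over `A` is bifurcate over `A` if it has at least one square-free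
extension (by a letter of `A`) at every position. -/
def IsBifurcate {A : Type*} (W : List A) : Prop :=
  SquareFree W ∧ ∀ i ≤ W.length, ∃ U : List A, IsExtensionAt W i U ∧ SquareFree U

/-- A bifurcate tree over `A`: a rooted tree whose vertices carry bifurcate words over `A`, in
such a way that the words at the children of a vertex `v` are single-letter extensions of the word
at `v`, at pairwise different positions. The order of a `RootedTree` is the ancestor order, with
the root `⊥`, so `v ⋖ w` says that `w` is a child of `v`. The same word may occur at several
vertices. -/
structure BifurcateTree (A : Type*) where
  /-- the underlying rooted tree -/
  tree : RootedTree.{0}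
  /-- the word at a vertex -/
  word : tree → List A
  isBifurcate : ∀ v, IsBifurcate (word v)
  isExtension : ∀ v w, v ⋖ w → ∃ i, IsExtensionAt (word v) i (word w)
  different_positions : ∀ v w w' i, v ⋖ w → v ⋖ w' →
    IsExtensionAt (word v) i (word w) → IsExtensionAt (word v) i (word w') → w = w'

/-- A bifurcate tree is complete if every vertex has the maximum possible number of children,
which is `n + 1` for a vertex with a word of length `n`. -/
def BifurcateTree.IsComplete {A : Type*} (B : BifurcateTree A) : Prop :=
  ∀ v : B.tree, {w : B.tree | v ⋖ w}.ncard = (B.word v).length + 1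

end BifurcateWords

namespace BifurcateWords

/-! Give every letter of a word a level and an index in ℤ, and print it as the pair of `quaternary`
of the level and `ternary` of the index: 4 · 3 = 12 letters. In a layered word the levels form a
lazy walk, and the indices grow by one along letters of a level that no lower letter separates. Such
a word can be extended anywhere: between equal levels goes a letter one level up, between different
levels goes a neighbour of the higher letter on its own level, and at an end a neighbour of the end
letter.

Layered words spell no square. If two adjacent blocks have the same letters, `walk_repeats` turns
equal colours of levels into equal levels, since `quaternary` is square-free and any three
consecutive colours are distinct. On the lowest level of the blocks the indices are then
consecutive, and their colours form a square in `ternary`, which is impossible.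

So layered words spell a language of square-free words that is extendable at every position.
`exists_complete_bifurcateTree` unfolds it into a tree whose vertices are histories of insertions.
-/

/-- A two-sided sequence is square-free if no block of length `q > 0` is followed by its copy. -/
def SquareFreeSeq {α : Type*} (f : ℤ → α) : Prop :=
  ∀ s q : ℤ, 0 < q → ¬ ∀ j, s ≤ j → j < s + q → f j = f (j + q)

/-! ### Thue–Morse sequences and the square-free ternary sequence -/

/-- The parity of the binary digit sum. -/
def digitParity (n : ℕ) : Bool := (Nat.digits 2 n).sum.bodd

lemma digitParity_two_mul (n : ℕ) : digitParity (2 * n) = digitParity n := by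
  rcases Nat.eq_zero_or_pos n with rfl | h
  · rfl
  · have := Nat.digits_add 2 (by norm_num) 0 n (by norm_num) (Or.inr h.ne')
    rw [zero_add] at this
    simp [digitParity, this]

lemma digitParity_two_mul_add_one (n : ℕ) : digitParity (2 * n + 1) = !digitParity n := by
  have := Nat.digits_add 2 (by norm_num) 1 n (by norm_num) (Or.inl (by norm_num))
  rw [add_comm] at this
  rw [digitParity, this]
  simp [digitParity]

/-- The two two-sided Thue–Morse sequences. -/
def thueMorse (c : Bool) : ℤ → Bool
  | Int.ofNat n => digitParity n
  | Int.negSucc n => xor c (digitParity n)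

/-- On the negative half, doubling turns `n` into `2 * n + 1` and flips the digit parity. Doubling
therefore exchanges the two sequences, and the induction for overlaps has to treat both. -/
lemma thueMorse_two_mul (c : Bool) (i : ℤ) : thueMorse c (2 * i) = thueMorse (!c) i := by
  rcases i with n | n
  · exact digitParity_two_mul n
  · have h : 2 * Int.negSucc n = Int.negSucc (2 * n + 1) := by omega
    rw [h]
    simp [thueMorse, digitParity_two_mul_add_one]

lemma thueMorse_two_mul_add_one (c : Bool) (i : ℤ) :
    thueMorse c (2 * i + 1) = !thueMorse (!c) i := by
  rcases i with n | n
  · exact digitParity_two_mul_add_one n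
  · have h : 2 * Int.negSucc n + 1 = Int.negSucc (2 * n) := by omega
    rw [h]
    simp [thueMorse, digitParity_two_mul]

lemma eq_xor_of_alternating {f : ℤ → Bool} {s : ℤ} {m : ℕ}
    (h : ∀ j, s ≤ j → j < s + m → f (j + 1) = !f j) :
    ∀ k : ℕ, k ≤ m → f (s + k) = xor (f s) k.bodd := by
  intro k
  induction k with
  | zero => simp
  | succ k ih =>
    intro hk
    have := h (s + k) (by omega) (by omega)
    rw [Nat.cast_succ, ← add_assoc, this, ih (by omega)]
    simp

/-- The two-sided Thue–Morse sequences contain no overlap. -/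
lemma thueMorse_overlapFree (q : ℕ) (hq : 0 < q) (c : Bool) (s : ℤ) :
    ¬ ∀ j, s ≤ j → j ≤ s + q → thueMorse c j = thueMorse c (j + q) := by
  induction q using Nat.strong_induction_on generalizing c s with
  | _ q ih =>
  intro h
  rcases Nat.even_or_odd' q with ⟨r, rfl | rfl⟩
  · rcases Int.emod_two_eq_zero_or_one s with hs | hs
    · refine ih r (by omega) (by omega) (!c) (s / 2) fun j h1 h2 => ?_
      have := h (2 * j) (by omega) (by omega)
      rw [show 2 * j + ((2 * r : ℕ) : ℤ) = 2 * (j + r) by push_cast; ring] at this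
      simpa only [thueMorse_two_mul] using this
    · refine ih r (by omega) (by omega) (!c) (s / 2) fun j h1 h2 => ?_
      have := h (2 * j + 1) (by omega) (by omega)
      rw [show 2 * j + 1 + ((2 * r : ℕ) : ℤ) = 2 * (j + r) + 1 by push_cast; ring] at this
      simpa only [thueMorse_two_mul_add_one, Bool.not_inj_iff] using this
  -- Values at 2i and 2i + 1 differ. A shift by an odd `q` exchanges parities, so the sequence
  -- alternates all the way from `s` to `s + q`, and its two end values differ.
  · have hpair : ∀ j, j % 2 = 0 → thueMorse c (j + 1) = !thueMorse c j := by
      intro j hj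
      obtain ⟨i, rfl⟩ : ∃ i, j = 2 * i := ⟨j / 2, by omega⟩
      rw [thueMorse_two_mul_add_one, thueMorse_two_mul]
    have halt : ∀ j, s ≤ j → j < s + (2 * r + 1 : ℕ) →
        thueMorse c (j + 1) = !thueMorse c j := by
      intro j h1 h2
      rcases Int.emod_two_eq_zero_or_one j with hj | hj
      · exact hpair j hj
      · rw [h j h1 (by omega), h (j + 1) (by omega) (by omega), add_right_comm]
        exact hpair _ (by push_cast; omega)
    have h1 := eq_xor_of_alternating halt _ le_rfl
    rw [← h s le_rfl (by omega)] at h1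
    simp at h1

/-- A square-free two-sided ternary sequence: the differences of a Thue–Morse sequence. -/
def ternary (i : ℤ) : ZMod 3 :=
  (thueMorse false (i + 1)).toNat - (thueMorse false i).toNat

lemma squareFreeSeq_ternary : SquareFreeSeq ternary := by
  intro s q hq h
  lift q to ℕ using hq.le
  have key : ∀ k : ℕ, k ≤ q →
      ((thueMorse false (s + k + q)).toNat : ZMod 3) - (thueMorse false (s + k)).toNat =
        (thueMorse false (s + q)).toNat - (thueMorse false s).toNat := by
    intro k
    induction k with
    | zero => simp
    | succ k ih =>
      intro hk
      have h1 := h (s + k) (by omega) (by omega)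
      have h2 := ih (by omega)
      simp only [ternary] at h1
      rw [add_right_comm _ (q : ℤ) 1] at h1
      rw [Nat.cast_succ, ← add_assoc]
      linear_combination h2 - h1
  -- Three bits in arithmetic progression modulo 3 are equal. Hence the constant difference in `key`
  -- vanishes, and the square becomes a Thue–Morse overlap.
  have hdec : ∀ x y z : Bool, ((z.toNat : ZMod 3) - y.toNat = y.toNat - x.toNat) → x = y := by
    decide
  have h0 := hdec _ _ _ (key q le_rfl)
  refine thueMorse_overlapFree q (by omega) false s fun j h1 h2 => ?_
  have h3 := key (j - s).toNat (by omega)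
  rw [Int.toNat_of_nonneg (by omega), add_sub_cancel, h0, sub_self] at h3
  have hinj : ∀ x y : Bool, ((y.toNat : ZMod 3) - x.toNat = 0) → x = y := by decide
  exact hinj _ _ h3

/-! ### The quaternary sequence -/

/-- A square-free two-sided sequence over four letters without palindromes of length at least
two: the square-free ternary sequence, with a fourth letter inserted after every second letter. -/
def quaternary (k : ℤ) : Option (ZMod 3) :=
  if k % 3 = 2 then none else some (ternary (2 * (k / 3) + k % 3))

lemma quaternary_eq_none_iff {k : ℤ} : quaternary k = none ↔ k % 3 = 2 := by
  simp [quaternary]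

lemma ternary_ne_succ (i : ℤ) : ternary i ≠ ternary (i + 1) := fun h =>
  squareFreeSeq_ternary i 1 one_pos fun j h1 h2 => by
    obtain rfl : j = i := by omega
    exact h

lemma quaternary_ne_succ (k : ℤ) : quaternary k ≠ quaternary (k + 1) := by
  unfold quaternary
  rcases (by omega : k % 3 = 0 ∨ k % 3 = 1 ∨ k % 3 = 2) with h | h | h
  · have h1 : (k + 1) % 3 = 1 := by omega
    have h2 : (k + 1) / 3 = k / 3 := by omega
    simpa [h, h1, h2] using ternary_ne_succ _
  · have h1 : (k + 1) % 3 = 2 := by omega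
    simp [h, h1]
  · have h1 : (k + 1) % 3 = 0 := by omega
    simp [h, h1]

lemma quaternary_ne_add_two (k : ℤ) : quaternary k ≠ quaternary (k + 2) := by
  unfold quaternary
  rcases (by omega : k % 3 = 0 ∨ k % 3 = 1 ∨ k % 3 = 2) with h | h | h
  · have h1 : (k + 2) % 3 = 2 := by omega
    simp [h, h1]
  · have h1 : (k + 2) % 3 = 0 := by omega
    have h2 : 2 * ((k + 2) / 3) = 2 * (k / 3) + 1 + 1 := by omega
    simpa [h, h1, h2] using ternary_ne_succ _
  · have h1 : (k + 2) % 3 = 1 := by omega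
    simp [h, h1]

/-- A period of at least three covers a `none`, so it is divisible by three. Deleting every `none`
then leaves a square in `ternary`. -/
lemma squareFreeSeq_quaternary : SquareFreeSeq quaternary := by
  intro s q hq h
  have h3 : q % 3 = 0 := by
    rcases (by omega : q = 1 ∨ q = 2 ∨ 3 ≤ q) with rfl | rfl | hq3
    · exact absurd (h s le_rfl (by omega)) (quaternary_ne_succ s)
    · exact absurd (h s le_rfl (by omega)) (quaternary_ne_add_two s)
    · obtain ⟨j, h1, h2, h4⟩ : ∃ j, s ≤ j ∧ j < s + q ∧ j % 3 = 2 :=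
        ⟨s + (2 - s) % 3, by omega, by omega, by omega⟩
      have := h j h1 h2
      rw [quaternary_eq_none_iff.2 h4, eq_comm, quaternary_eq_none_iff] at this
      omega
  obtain ⟨r, rfl⟩ : ∃ r, q = 3 * r := ⟨q / 3, by omega⟩
  refine squareFreeSeq_ternary (2 * (s / 3) + s % 3) (2 * r) (by omega) fun j h1 h2 => ?_
  have := h (3 * (j / 2) + j % 2) (by omega) (by omega)
  have e1 : (3 * (j / 2) + j % 2) % 3 = j % 2 := by omega
  have e2 : (3 * (j / 2) + j % 2 + 3 * r) % 3 = j % 2 := by omega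
  have e3 : 2 * ((3 * (j / 2) + j % 2) / 3) + j % 2 = j := by omega
  have e4 : 2 * ((3 * (j / 2) + j % 2 + 3 * r) / 3) + j % 2 = j + 2 * r := by omega
  have e5 : j % 2 ≠ 2 := by omega
  simpa [quaternary, e1, e2, e3, e4, e5] using this

/-! ### Lazy walks on a coloured line -/

lemma exists_eq_of_abs_step_le_one {f : ℕ → ℤ} {m : ℕ} (h : ∀ j < m, |f (j + 1) - f j| ≤ 1)
    {y : ℤ} (hy : f 0 ≤ y ∧ y ≤ f m ∨ f m ≤ y ∧ y ≤ f 0) : ∃ j ≤ m, f j = y := by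
  induction m with
  | zero => exact ⟨0, le_rfl, by omega⟩
  | succ m ih =>
    have h1 := abs_le.1 (h m m.lt_succ_self)
    by_cases hm : f (m + 1) = y
    · exact ⟨_, le_rfl, hm⟩
    · obtain ⟨j, hj, e⟩ := ih (fun j hj => h j (by omega)) (by omega)
      exact ⟨j, by omega, e⟩

/-- If three consecutive colours are always distinct, then two walks with the same colours
move in parallel or symmetrically. -/
lemma parallel_or_symmetric {α : Type*} {p : ℤ → α} (h1 : ∀ k, p k ≠ p (k + 1))
    (h2 : ∀ k, p k ≠ p (k + 2)) {u v : ℕ → ℤ} {m : ℕ}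
    (hu : ∀ j < m, |u (j + 1) - u j| ≤ 1) (hv : ∀ j < m, |v (j + 1) - v j| ≤ 1)
    (hp : ∀ j ≤ m, p (u j) = p (v j)) :
    (∀ j ≤ m, u j = u 0 ∧ v j = v 0) ∨
    ((∀ j ≤ m, v j - u j = v 0 - u 0) ∧
      ∃ d, (d = 1 ∨ d = -1) ∧ p (u m - d) = p (v m - d)) ∨
    ((∀ j ≤ m, u j + v j = u 0 + v 0) ∧
      ∃ d, (d = 1 ∨ d = -1) ∧ p (u m - d) = p (v m + d)) := by
  induction m with
  | zero => left; intro j hj; obtain rfl : j = 0 := by omega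
            simp
  | succ m ih =>
    have ih := ih (fun j hj => hu j (by omega)) (fun j hj => hv j (by omega))
      (fun j hj => hp j (by omega))
    have hpm := hp m (by omega)
    have hpm' := hp (m + 1) le_rfl
    have hne : ∀ x y, p x = p y → x - y ≠ 1 ∧ x - y ≠ -1 ∧ x - y ≠ 2 ∧ x - y ≠ -2 := by
      intro x y hxy
      refine ⟨fun h => h1 y ?_, fun h => h1 x ?_, fun h => h2 y ?_, fun h => h2 x ?_⟩
      · rw [← hxy]; congr 1; omega
      · rw [hxy]; congr 1; omega
      · rw [← hxy]; congr 1; omega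
      · rw [hxy]; congr 1; omega
    have hum := abs_le.1 (hu m m.lt_succ_self)
    have hvm := abs_le.1 (hv m m.lt_succ_self)
    have hext : ∀ {P : ℕ → Prop}, (∀ j ≤ m, P j) → P (m + 1) → ∀ j ≤ m + 1, P j := by
      intro P hP hP' j hj
      rcases Nat.le_succ_iff.1 hj with hj | rfl
      exacts [hP j hj, hP']
    have hcase : (u (m + 1) = u m ∧ v (m + 1) = v m) ∨
        ∃ e, (e = 1 ∨ e = -1) ∧ u (m + 1) = u m + e ∧
          (v (m + 1) = v m + e ∨ v (m + 1) = v m - e) := by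
      by_cases hu0 : u (m + 1) = u m
      · left
        refine ⟨hu0, ?_⟩
        have := hne (v (m + 1)) (v m) (by rw [← hpm, ← hpm', hu0])
        omega
      · right
        have : v (m + 1) ≠ v m := by
          intro hv0
          have := hne (u (m + 1)) (u m) (by rw [hpm, hpm', hv0])
          omega
        exact ⟨u (m + 1) - u m, by omega, by omega, by omega⟩
    -- `d` is the direction of the last move, so the positions just left have equal colours. A
    -- change between parallel and symmetric motion would give one colour to two positions at
    -- distance two.
    rcases hcase with ⟨hu0, hv0⟩ | ⟨e, he, hue, hve | hve⟩
    · rw [hu0, hv0]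
      refine ih.imp (fun h => hext h ?_) (Or.imp (fun h => ⟨hext h.1 ?_, h.2⟩)
        (fun h => ⟨hext h.1 ?_, h.2⟩))
      · rw [hu0, hv0]; exact h m le_rfl
      · rw [hu0, hv0]; exact h.1 m le_rfl
      · rw [hu0, hv0]; exact h.1 m le_rfl
    · have hd : p (u (m + 1) - e) = p (v (m + 1) - e) := by
        rw [hue, hve, add_sub_cancel_right, add_sub_cancel_right, hpm]
      right; left
      refine ⟨?_, e, he, hd⟩
      rcases ih with h | ⟨h, -⟩ | ⟨h, d, hd, hpd⟩
      · exact hext (fun j hj => by rw [(h j hj).1, (h j hj).2])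
          (by have := h m le_rfl; omega)
      · exact hext h (by have := h m le_rfl; omega)
      · exfalso
        rw [hue, hve] at hpm'
        rcases (by omega : e = d ∨ e = -d) with rfl | rfl
        · have := hne (u m - e) (u m + e) (by rw [hpd, hpm'])
          omega
        · have := hne (v m + d) (v m + -d) (by rw [← hpd, ← hpm']; rfl)
          omega
    · have hd : p (u (m + 1) - e) = p (v (m + 1) + e) := by
        rw [hue, hve, add_sub_cancel_right, sub_add_cancel, hpm]
      right; right
      refine ⟨?_, e, he, hd⟩
      rcases ih with h | ⟨h, d, hd, hpd⟩ | ⟨h, -⟩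
      · exact hext (fun j hj => by rw [(h j hj).1, (h j hj).2])
          (by have := h m le_rfl; omega)
      · exfalso
        rw [hue, hve] at hpm'
        rcases (by omega : e = d ∨ e = -d) with rfl | rfl
        · have := hne (u m - e) (u m + e) (by rw [hpd, hpm'])
          omega
        · have := hne (v m - d) (v m - -d) (by rw [← hpd, ← hpm']; rfl)
          omega
      · exact hext h (by have := h m le_rfl; omega)

/-- In a square-free colouring of the line in which three consecutive colours are always
distinct, a lazy walk whose colours form a square repeats its first half. -/
lemma walk_repeats {α : Type*} {p : ℤ → α} (h1 : ∀ k, p k ≠ p (k + 1))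
    (h2 : ∀ k, p k ≠ p (k + 2)) (hsq : SquareFreeSeq p) {x : ℕ → ℤ} {n : ℕ}
    (hx : ∀ j, j + 1 < 2 * n → |x (j + 1) - x j| ≤ 1)
    (hp : ∀ j < n, p (x j) = p (x (n + j))) : ∀ j < n, x j = x (n + j) := by
  obtain _ | m := n
  · simp
  have hu : ∀ j < m, |x (j + 1) - x j| ≤ 1 := fun j hj => hx j (by omega)
  have hv : ∀ j < m, |x (m + 1 + (j + 1)) - x (m + 1 + j)| ≤ 1 :=
    fun j hj => hx (m + 1 + j) (by omega)
  have hmid := abs_le.1 (hx m (by omega))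
  have hpar := parallel_or_symmetric h1 h2 (u := x) (v := fun j => x (m + 1 + j)) hu hv
    fun j hj => hp j (by omega)
  have hpar' : (∀ j ≤ m, x (m + 1 + j) - x j = x (m + 1) - x 0) ∨
      (∀ j ≤ m, x j + x (m + 1 + j) = x 0 + x (m + 1)) := by
    rcases hpar with h | h | h
    · left
      intro j hj
      have h3 := (h j hj).1
      have h4 := (h j hj).2
      simp only [add_zero] at h4
      omega
    · exact Or.inl h.1
    · exact Or.inr h.1
  rcases hpar' with h | h
  -- The first walk covers all positions from `x 0` to `x m`, and `x (m + 1)` is at most one step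
  -- further. A nonzero shift would thus give a square in `p` with that shift as period.
  · have hstep : ∀ y, (x 0 ≤ y ∧ y ≤ x m ∨ x m ≤ y ∧ y ≤ x 0) →
        p y = p (y + (x (m + 1) - x 0)) := by
      intro y hy
      obtain ⟨j, hj, rfl⟩ := exists_eq_of_abs_step_le_one hu hy
      rw [hp j (by omega), ← h j hj, add_sub_cancel]
    rcases lt_trichotomy (x (m + 1) - x 0) 0 with hd | hd | hd
    · refine absurd (fun j h3 h4 => ?_)
        (hsq (x 0 + 2 * (x (m + 1) - x 0) + 1) (-(x (m + 1) - x 0)) (by omega))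
      rw [hstep (j + -(x (m + 1) - x 0)) (by omega), neg_add_cancel_right]
    · intro j hj
      have := h j (by omega)
      omega
    · exact absurd (fun j h3 h4 => hstep j (by omega)) (hsq (x 0) _ hd)
  -- The gap between the walks avoids ±1 and ±2 and changes by at most two at each step, so it stays
  -- zero or keeps its sign. In the latter case `x m` and `x (m + 1)` would lie at least three
  -- apart, on opposite sides of the centre of symmetry.
  · have hne : ∀ j ≤ m, x j - x (m + 1 + j) = 0 ∨ 3 ≤ x j - x (m + 1 + j) ∨
        x j - x (m + 1 + j) ≤ -3 := by
      intro j hj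
      have hpj := hp j (by omega)
      by_contra hcon
      rcases (by omega : x j = x (m + 1 + j) + 1 ∨ x (m + 1 + j) = x j + 1 ∨
        x j = x (m + 1 + j) + 2 ∨ x (m + 1 + j) = x j + 2) with e | e | e | e
      · rw [e] at hpj; exact h1 _ hpj.symm
      · rw [e] at hpj; exact h1 _ hpj
      · rw [e] at hpj; exact h2 _ hpj.symm
      · rw [e] at hpj; exact h2 _ hpj
    have hsign : ∀ j ≤ m, (x 0 - x (m + 1) = 0 ∧ x j - x (m + 1 + j) = 0) ∨
        (3 ≤ x 0 - x (m + 1) ∧ 3 ≤ x j - x (m + 1 + j)) ∨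
        (x 0 - x (m + 1) ≤ -3 ∧ x j - x (m + 1 + j) ≤ -3) := by
      intro j
      induction j with
      | zero => intro _; have := hne 0 (by omega); rw [add_zero] at this ⊢; omega
      | succ j ih =>
        intro hj
        have h3 := ih (by omega)
        have h4 := hne (j + 1) hj
        have h5 := h j (by omega)
        have h6 := h (j + 1) hj
        have h7 := abs_le.1 (hu j (by omega))
        omega
    have hend := hsign m le_rfl
    have hsum := h m le_rfl
    intro j hj
    have := hsign j (by omega)
    omega

/-! ### Layered words and their extensions -/

/-- The letters of a word carry a level and an index. `Precedes a S` says that the first letter of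
`S` whose level does not exceed that of `a`, if it is on the level of `a`, has the next index. -/
def Precedes (a : ℤ × ℤ) : List (ℤ × ℤ) → Prop
  | [] => True
  | b :: S => (a.1 < b.1 → Precedes a S) ∧ (a.1 = b.1 → b.2 = a.2 + 1)

/-- A word of letters with levels and indices is layered if neighbouring levels differ by at most
one, and consecutive letters of a level with only higher letters between them have consecutive
indices. -/
def Layered : List (ℤ × ℤ) → Prop
  | [] => True
  | a :: S => Precedes a S ∧ (∀ b ∈ S.head?, |b.1 - a.1| ≤ 1) ∧ Layered S

lemma Precedes.of_append {a : ℤ × ℤ} {S R : List (ℤ × ℤ)} (h : Precedes a (S ++ R)) :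
    Precedes a S := by
  induction S with
  | nil => trivial
  | cons b S ih => exact ⟨fun hb => ih (h.1 hb), h.2⟩

lemma Layered.of_append_left {S R : List (ℤ × ℤ)} (h : Layered (S ++ R)) : Layered S := by
  induction S with
  | nil => trivial
  | cons b S ih =>
    refine ⟨h.1.of_append, fun c hc => h.2.1 c ?_, ih h.2.2⟩
    cases S with
    | nil => simp at hc
    | cons => exact hc

lemma Layered.of_append_right {S R : List (ℤ × ℤ)} (h : Layered (S ++ R)) : Layered R := by
  induction S with
  | nil => exact h
  | cons b S ih => exact ih h.2.2

/-- Between `u` and `v` there is room for a letter. -/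
lemma exists_between (u v : ℤ × ℤ) (h : |v.1 - u.1| ≤ 1) : ∃ x : ℤ × ℤ,
    u.1 ≤ x.1 ∧ v.1 ≤ x.1 ∧ x.1 ≤ u.1 + 1 ∧ x.1 ≤ v.1 + 1 ∧
      (u.1 = x.1 → x.2 = u.2 + 1) ∧ (x.1 = v.1 → v.2 = x.2 + 1) ∧
      (u.1 = v.1 → u.1 < x.1) := by
  have h := abs_le.1 h
  rcases (by omega : v.1 = u.1 ∨ v.1 = u.1 + 1 ∨ v.1 + 1 = u.1) with e | e | e
  -- The new letter is enclosed by lower ones, so its index is free.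
  · exact ⟨(u.1 + 1, 0), by simp; omega⟩
  · exact ⟨(v.1, v.2 - 1), by simp; omega⟩
  · exact ⟨(u.1, u.2 + 1), by simp; omega⟩

/-- The second claim carries the induction: letters to the left must tolerate the insertion. They
do, because the new letter is no lower than its left neighbour, and a letter that looks past the
neighbour also looks past the new letter. -/
lemma Layered.exists_insert_succ {D : List (ℤ × ℤ)} (hD : Layered D) {i : ℕ}
    (hi : i < D.length) : ∃ x, Layered (D.take (i + 1) ++ x :: D.drop (i + 1)) ∧
      ∀ a, Precedes a D → Precedes a (D.take (i + 1) ++ x :: D.drop (i + 1)) := by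
  induction D generalizing i with
  | nil => simp at hi
  | cons u S ih =>
  obtain ⟨h1, h2, h3⟩ := hD
  rcases i with _ | i
  · rcases S with _ | ⟨v, S⟩
    · exact ⟨(u.1, u.2 + 1), by simp [Layered, Precedes], fun a ha => by
        simp only [Precedes, List.take, List.drop, List.nil_append, List.cons_append] at ha ⊢
        refine ⟨fun h => ⟨fun _ => trivial, fun e => ?_⟩, ha.2⟩
        exact absurd e h.ne⟩
    · obtain ⟨x, k1, k2, k3, k4, k5, k6, k7⟩ := exists_between u v (h2 v rfl)
      refine ⟨x, ?_, ?_⟩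
      · simp only [Layered, Precedes, List.take, List.drop, List.nil_append, List.cons_append,
          List.head?_cons, Option.mem_def, Option.some.injEq, forall_eq'] at *
        refine ⟨⟨fun _ => h1, k5⟩, abs_le.2 ⟨by omega, by omega⟩,
          ⟨fun h => absurd h (by omega), k6⟩, abs_le.2 ⟨by omega, by omega⟩, h3⟩
      · intro a ha
        simp only [Precedes, List.take, List.drop, List.nil_append, List.cons_append] at ha ⊢
        exact ⟨fun h => ⟨fun _ => ha.1 h, fun e => absurd e (by omega)⟩, ha.2⟩
  · obtain ⟨x, h4, h5⟩ := ih h3 (i := i) (by simpa using hi)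
    refine ⟨x, ⟨h5 u h1, ?_, h4⟩, fun a ha => ⟨fun h => h5 a (ha.1 h), ha.2⟩⟩
    rcases S with _ | ⟨v, S⟩
    · simp at hi
    · exact h2

/-- Layered words can be extended at every position. -/
lemma Layered.exists_insert {D : List (ℤ × ℤ)} (hD : Layered D) {i : ℕ}
    (hi : i ≤ D.length) : ∃ x, Layered (D.take i ++ x :: D.drop i) := by
  rcases i with _ | i
  · rcases D with _ | ⟨v, S⟩
    · exact ⟨(0, 0), by simp [Layered, Precedes]⟩
    · refine ⟨(v.1, v.2 - 1), ?_⟩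
      simp only [List.take, List.drop, List.nil_append]
      exact ⟨⟨fun h => absurd h (lt_irrefl _), fun _ => by simp⟩, by simp, hD⟩
  · obtain ⟨x, hx, -⟩ := hD.exists_insert_succ hi
    exact ⟨x, hx⟩

lemma Layered.abs_getElem_sub_le_one {D : List (ℤ × ℤ)} (hD : Layered D) {j : ℕ}
    (hj : j + 1 < D.length) : |D[j + 1].1 - D[j].1| ≤ 1 := by
  induction D generalizing j with
  | nil => simp at hj
  | cons u S ih =>
    rcases j with _ | j
    · rcases S with _ | ⟨v, S⟩
      · simp at hj
      · exact hD.2.1 v rfl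
    · simpa using ih hD.2.2 (by simpa using hj)

/-! ### Layered words are square-free -/

/-- The indices of the letters of level `m`. -/
def indices (m : ℤ) (D : List (ℤ × ℤ)) : List ℤ := (D.filter (·.1 = m)).map Prod.snd

lemma Precedes.head_indices {a : ℤ × ℤ} {D : List (ℤ × ℤ)} (h : Precedes a D)
    (hm : ∀ b ∈ D, a.1 ≤ b.1) : ∀ i ∈ (indices a.1 D).head?, i = a.2 + 1 := by
  induction D with
  | nil => simp [indices]
  | cons b S ih =>
    rcases (hm b (by simp)).eq_or_lt with e | e
    · intro i hi
      simp only [indices, List.filter_cons, e, decide_true, if_true, List.map_cons,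
        List.head?_cons, Option.mem_def, Option.some.injEq] at hi
      rw [← hi]
      exact h.2 e
    · have := ih (h.1 e) fun c hc => hm c (by simp [hc])
      simpa [indices, List.filter_cons, e.ne'] using this

/-- The bound on `m` is essential: on a higher level, a lower letter in between would break the run
of indices. -/
lemma Layered.isChain_indices {D : List (ℤ × ℤ)} (hD : Layered D) {m : ℤ}
    (hm : ∀ b ∈ D, m ≤ b.1) : (indices m D).IsChain (fun i j => j = i + 1) := by
  induction D with
  | nil => simp [indices]
  | cons b S ih =>
    have hS := ih hD.2.2 fun c hc => hm c (by simp [hc])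
    by_cases e : b.1 = m
    · subst e
      have : indices b.1 (b :: S) = b.2 :: indices b.1 S := by simp [indices]
      rw [this, List.isChain_cons]
      exact ⟨hD.1.head_indices fun c hc => hm c (by simp [hc]), hS⟩
    · have : indices m (b :: S) = indices m S := by simp [indices, e]
      rwa [this]

lemma getElem_eq_of_isChain_add_one {L : List ℤ} (h : L.IsChain (fun i j => j = i + 1)) (k : ℕ)
    (hk : k < L.length) : L[k] = L[0] + k := by
  induction k with
  | zero => simp
  | succ k ih =>
    have := List.isChain_iff_getElem.1 h k (by omega)
    rw [this, ih (by omega)]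
    push_cast
    ring

/-- The letter, out of twelve, at a given level and index. -/
def letter (b : ℤ × ℤ) : Option (ZMod 3) × ZMod 3 := (quaternary b.1, ternary b.2)

/-- Consecutive indices never spell a square. -/
lemma eq_nil_of_isChain_append {L M : List ℤ} (h : (L ++ M).IsChain (fun i j => j = i + 1))
    (hLM : L.map ternary = M.map ternary) : L = [] := by
  by_contra hne
  have hlen : L.length = M.length := by simpa using congrArg List.length hLM
  have hpos := List.length_pos_iff.2 hne
  refine squareFreeSeq_ternary ((L ++ M)[0]'(by simp; omega)) L.length (by omega) fun j h1 h2 => ?_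
  obtain ⟨k, hk⟩ := Int.le.dest h1
  have e1 := getElem_eq_of_isChain_add_one h k (by simp; omega)
  have e2 := getElem_eq_of_isChain_add_one h (L.length + k) (by simp; omega)
  rw [List.getElem_append_left (by omega)] at e1
  rw [List.getElem_append_right (by omega)] at e2
  simp only [Nat.add_sub_cancel_left] at e2
  have e3 : (L.map ternary)[k]'(by simp; omega) = (M.map ternary)[k]'(by simp; omega) := by
    simp only [hLM]
  rw [List.getElem_map, List.getElem_map, e1, e2] at e3
  rw [← hk, e3]
  push_cast
  congr 1
  ring

lemma Layered.levels_eq {Y Z : List (ℤ × ℤ)} (h : Layered (Y ++ Z))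
    (hYZ : Y.map letter = Z.map letter) : Y.map Prod.fst = Z.map Prod.fst := by
  have hlen : Y.length = Z.length := by simpa using congrArg List.length hYZ
  have hx : ∀ j (hj : j < (Y ++ Z).length), ((Y ++ Z)[j]?.getD 0).1 = (Y ++ Z)[j].1 :=
    fun j hj => by simp [List.getElem?_eq_getElem hj]
  have hY : ∀ j (hj : j < Y.length), ((Y ++ Z)[j]?.getD 0).1 = Y[j].1 := fun j hj => by
    rw [hx j (by simp; omega), List.getElem_append_left]
  have hZ : ∀ j (hj : j < Z.length), ((Y ++ Z)[Y.length + j]?.getD 0).1 = Z[j].1 :=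
    fun j hj => by
      rw [hx _ (by simp; omega), List.getElem_append_right (by omega)]
      simp
  have := walk_repeats quaternary_ne_succ quaternary_ne_add_two squareFreeSeq_quaternary
    (x := fun j => ((Y ++ Z)[j]?.getD 0).1) (n := Y.length)
    (fun j hj => by
      have hj' : j + 1 < (Y ++ Z).length := by simp; omega
      simp only [hx _ hj', hx j (by omega)]
      exact h.abs_getElem_sub_le_one hj')
    (fun j hj => by
      simp only [hY j hj, hZ j (by omega)]
      have e : (Y.map letter)[j]'(by simpa) = (Z.map letter)[j]'(by simp; omega) := by
        simp only [hYZ]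
      rw [List.getElem_map, List.getElem_map] at e
      exact congrArg Prod.fst e)
  refine List.ext_getElem (by simpa) fun j h1 h2 => ?_
  rw [List.length_map] at h1 h2
  have := this j h1
  simp only [hY j h1, hZ j h2] at this
  simpa using this

lemma map_ternary_indices_congr {Y Z : List (ℤ × ℤ)} (m : ℤ)
    (h1 : Y.map Prod.fst = Z.map Prod.fst) (h2 : Y.map letter = Z.map letter) :
    (indices m Y).map ternary = (indices m Z).map ternary := by
  induction Y generalizing Z with
  | nil => obtain rfl : Z = [] := by simpa using h1.symm
           rfl
  | cons y Y ih =>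
    rcases Z with _ | ⟨z, Z⟩
    · simp at h1
    · simp only [List.map_cons, List.cons.injEq, letter, Prod.mk.injEq] at h1 h2
      have := ih h1.2 h2.2
      by_cases e : z.1 = m
      · simpa [indices, h1.1, e, h2.1.2] using this
      · simpa [indices, h1.1, e] using this

lemma Layered.eq_nil_of_map_letter_eq {Y Z : List (ℤ × ℤ)} (h : Layered (Y ++ Z))
    (hYZ : Y.map letter = Z.map letter) : Y = [] := by
  by_contra hne
  have hfst := h.levels_eq hYZ
  obtain ⟨b, hb, hmin⟩ := Y.toFinset.exists_min_image Prod.fst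
    ((List.toFinset_nonempty_iff Y).2 hne)
  simp only [List.mem_toFinset] at hb hmin
  -- Since the levels of the blocks agree, the lowest level of `Y` is also the lowest of `Z`.
  have hch := h.isChain_indices (m := b.1) fun c hc => by
    rcases List.mem_append.1 hc with hc | hc
    · exact hmin c hc
    · have : c.1 ∈ Y.map Prod.fst := hfst ▸ List.mem_map_of_mem hc
      obtain ⟨d, hd, e⟩ := List.mem_map.1 this
      exact e ▸ hmin d hd
  have happ : indices b.1 (Y ++ Z) = indices b.1 Y ++ indices b.1 Z := by simp [indices]
  rw [happ] at hch
  have hnil := eq_nil_of_isChain_append hch (map_ternary_indices_congr b.1 hfst hYZ)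
  have : b.2 ∈ indices b.1 Y := by
    simp only [indices, List.mem_map, List.mem_filter]
    exact ⟨b, ⟨hb, by simp⟩, rfl⟩
  rw [hnil] at this
  simp at this

/-- Layered words spell square-free words. -/
lemma Layered.squareFree {A : Type*} {f : Option (ZMod 3) × ZMod 3 → A}
    (hf : Function.Injective f) {D : List (ℤ × ℤ)} (h : Layered D) :
    SquareFree (D.map fun b => f (letter b)) := by
  rintro X hX ⟨s, t, e⟩
  obtain ⟨D₁, R, rfl, h1, -⟩ := List.map_eq_append_iff.1 e.symm
  obtain ⟨P, E, rfl, -, h2⟩ := List.map_eq_append_iff.1 h1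
  obtain ⟨Y, Z, rfl, h3, h4⟩ := List.map_eq_append_iff.1 h2
  have hYZ : Y.map letter = Z.map letter := by
    apply List.map_injective_iff.2 hf
    rw [List.map_map, List.map_map]
    exact h3.trans h4.symm
  obtain rfl := h.of_append_left.of_append_right.eq_nil_of_map_letter_eq hYZ
  exact hX h3.symm

/-! ### The rooted tree of insertion histories, ordered by suffix -/

/-- The longest common suffix of two lists. -/
def commonSuffix {α : Type*} [DecidableEq α] : List α → List α → List α
  | [], _ => []
  | a :: u, v => if (a :: u) <:+ v then a :: u else commonSuffix u v

lemma commonSuffix_suffix_left {α : Type*} [DecidableEq α] (u v : List α) :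
    commonSuffix u v <:+ u := by
  induction u with
  | nil => exact List.suffix_rfl
  | cons a u ih =>
    rw [commonSuffix]
    split_ifs
    exacts [List.suffix_rfl, ih.trans (List.suffix_cons a u)]

lemma commonSuffix_suffix_right {α : Type*} [DecidableEq α] (u v : List α) :
    commonSuffix u v <:+ v := by
  induction u with
  | nil => exact List.nil_suffix
  | cons a u ih =>
    rw [commonSuffix]
    split_ifs with h
    exacts [h, ih]

lemma suffix_commonSuffix {α : Type*} [DecidableEq α] {u v w : List α} (hu : w <:+ u)
    (hv : w <:+ v) : w <:+ commonSuffix u v := by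
  induction u with
  | nil => exact hu
  | cons a u ih =>
    rw [commonSuffix]
    split_ifs with h
    · exact hu
    · rcases List.suffix_cons_iff.1 hu with rfl | hu
      exacts [absurd hv h, ih hu]

/-- A list of insertion positions, the latest first, is admissible if it can be applied to a
one-letter word. -/
def Admissible (l : List ℕ) : Prop :=
  ∀ i t, (i :: t) <:+ l → i ≤ t.length + 1

lemma Admissible.of_suffix {l l' : List ℕ} (h : Admissible l) (hl : l' <:+ l) : Admissible l' :=
  fun i t ht => h i t (ht.trans hl)

lemma admissible_nil : Admissible [] := fun i t h => by simp at h

lemma Admissible.cons {l : List ℕ} (h : Admissible l) {i : ℕ} (hi : i ≤ l.length + 1) :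
    Admissible (i :: l) := fun j t ht => by
  rcases List.suffix_cons_iff.1 ht with e | ht
  · obtain ⟨rfl, rfl⟩ := List.cons.inj e
    exact hi
  · exact h j t ht

/-- The histories of insertions into a one-letter word. -/
def History : Type := {l : List ℕ // Admissible l}

namespace History

instance : PartialOrder History where
  le u v := u.1 <:+ v.1
  le_refl _ := List.suffix_rfl
  le_trans _ _ _ := List.IsSuffix.trans
  le_antisymm u v h h' :=
    Subtype.ext (h.eq_of_length (le_antisymm h.length_le h'.length_le))

lemma le_def {u v : History} : u ≤ v ↔ u.1 <:+ v.1 := Iff.rfl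

instance : SemilatticeInf History where
  inf u v := ⟨commonSuffix u.1 v.1, u.2.of_suffix (commonSuffix_suffix_left _ _)⟩
  inf_le_left u v := commonSuffix_suffix_left u.1 v.1
  inf_le_right u v := commonSuffix_suffix_right u.1 v.1
  le_inf _ _ _ := suffix_commonSuffix

instance : OrderBot History where
  bot := ⟨[], admissible_nil⟩
  bot_le _ := List.nil_suffix

lemma length_lt {u v : History} (h : u < v) : u.1.length < v.1.length := by
  refine h.le.length_le.lt_of_ne fun e => h.ne ?_
  exact Subtype.ext (List.IsSuffix.eq_of_length h.le e)

lemma le_tail_of_lt {u v : History} (h : u < v) : u.1 <:+ v.1.tail := by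
  obtain ⟨v, hv⟩ := v
  rcases v with _ | ⟨i, v⟩
  · exact h.le
  · rcases List.suffix_cons_iff.1 h.le with e | h'
    · exact absurd (Subtype.ext e) h.ne
    · exact h'

instance : PredOrder History where
  pred v := ⟨v.1.tail, v.2.of_suffix (List.tail_suffix _)⟩
  pred_le v := List.tail_suffix v.1
  min_of_le_pred {v} h := by
    have h := List.IsSuffix.length_le h
    intro w _
    have : v.1 = [] := by
      rw [← List.length_eq_zero_iff]
      rw [List.length_tail] at h
      by_contra hne
      omega
    rw [le_def, this]
    exact List.nil_suffix
  le_pred_of_lt := le_tail_of_lt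

instance : WellFoundedLT History :=
  ⟨Subrelation.wf (fun h => length_lt h) (measure fun v : History => v.1.length).wf⟩

/-- The history `v`, followed by an insertion at position `i`. -/
def child (v : History) (i : ℕ) (hi : i ≤ v.1.length + 1) : History := ⟨i :: v.1, v.2.cons hi⟩

lemma covBy_iff {v w : History} : v ⋖ w ↔ ∃ i hi, w = v.child i hi := by
  constructor
  · intro h
    have h1 := le_tail_of_lt h.1
    obtain ⟨w, hw⟩ := w
    rcases w with _ | ⟨i, t⟩
    · exact absurd (length_lt h.1) (by simp)
    · have ht : Admissible t := hw.of_suffix (List.suffix_cons i t)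
      have hvt : v = ⟨t, ht⟩ := by
        by_contra hne
        refine h.2 (lt_of_le_of_ne (show v ≤ ⟨t, ht⟩ from h1) hne) (lt_of_le_of_ne
          (List.suffix_cons i t) fun e => ?_)
        simpa using congrArg (fun x : History => x.1.length) e
      subst hvt
      exact ⟨i, hw i t List.suffix_rfl, rfl⟩
  · rintro ⟨i, hi, rfl⟩
    refine ⟨lt_of_le_of_ne (List.suffix_cons i v.1) fun e => ?_, fun c h1 h2 => ?_⟩
    · have := congrArg (fun x : History => x.1.length) e
      simp [child] at this
    · have := length_lt h1
      have := length_lt h2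
      simp only [child, List.length_cons] at this
      omega

lemma child_inj {v : History} {i j : ℕ} {hi hj} (h : v.child i hi = v.child j hj) : i = j :=
  (List.cons.inj (Subtype.ext_iff.1 h)).1

lemma ncard_covBy (v : History) : {w | v ⋖ w}.ncard = v.1.length + 2 := by
  have : {w | v ⋖ w} = Set.range fun i : Fin (v.1.length + 2) => v.child i (by omega) := by
    ext w
    simp only [Set.mem_ofPred_eq, covBy_iff, Set.mem_range]
    constructor
    · rintro ⟨i, hi, rfl⟩
      exact ⟨⟨i, by omega⟩, rfl⟩
    · rintro ⟨i, rfl⟩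
      exact ⟨i, by omega, rfl⟩
  rw [this, ← Set.image_univ, Set.ncard_image_of_injective _ fun i j h => Fin.ext (child_inj h),
    Set.ncard_univ, Nat.card_eq_fintype_card, Fintype.card_fin]

end History

/-! ### From an extendable language to a complete bifurcate tree -/

lemma IsExtensionAt.length {A : Type*} {W U : List A} {i : ℕ} (h : IsExtensionAt W i U) :
    U.length = W.length + 1 := by
  obtain ⟨hi, x, rfl⟩ := h
  simp
  omega

/-- A square-free word extends a given word at one position only. -/
lemma IsExtensionAt.position_unique {A : Type*} {W U : List A} {i j : ℕ}
    (hi : IsExtensionAt W i U) (hj : IsExtensionAt W j U) (hU : SquareFree U) : i = j := by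
  wlog hij : i < j generalizing i j
  · rcases (not_lt.1 hij).eq_or_lt with h | h
    exacts [h.symm, (this hj hi h).symm]
  exfalso
  obtain ⟨hi', x, hx⟩ := hi
  obtain ⟨hj', y, hy⟩ := hj
  -- For `i < j`, letter `i` of `U` is both the inserted `x` and letter `i` of `W`, which the first
  -- insertion pushes right behind `x`: a square.
  have e1 : U[i]? = some x := by
    rw [hx, List.getElem?_append_right (by simp)]
    simp [hi']
  have e2 : U[i]? = W[i]? := by
    rw [hy, List.getElem?_append_left (by simp; omega), List.getElem?_take_of_lt hij]
  have hlt : i < W.length := by omega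
  have e3 : W.drop i = x :: W.drop (i + 1) := by
    rw [List.drop_eq_getElem_cons hlt]
    rw [e2, List.getElem?_eq_getElem hlt, Option.some.injEq] at e1
    rw [e1]
  refine hU [x] (by simp) ⟨W.take i, W.drop (i + 1), ?_⟩
  rw [hx, e3]
  simp

/-- A set of square-free words that contains `[a]` and contains, with each of its words, an
extension at every position, can be arranged in a complete bifurcate tree. -/
theorem exists_complete_bifurcateTree {A : Type*} {a : A} {L : Set (List A)} (ha : [a] ∈ L)
    (hL : ∀ W ∈ L, SquareFree W) (hext : ∀ W ∈ L, ∀ i ≤ W.length, ∃ U ∈ L, IsExtensionAt W i U) :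
    ∃ B : BifurcateTree A, B.IsComplete ∧ B.word ⊥ = [a] ∧
      ∀ v : B.tree, ∀ i ≤ (B.word v).length,
        ∃! w : B.tree, v ⋖ w ∧ IsExtensionAt (B.word v) i (B.word w) := by
  -- The implication makes the choice of extensions total; values at positions out of range are
  -- irrelevant.
  have hext' : ∀ (W : L) (i : ℕ), ∃ U : L, i ≤ W.1.length → IsExtensionAt W.1 i U.1 := by
    intro W i
    by_cases hi : i ≤ W.1.length
    · obtain ⟨U, hU, h⟩ := hext W.1 W.2 i hi
      exact ⟨⟨U, hU⟩, fun _ => h⟩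
    · exact ⟨W, fun h => absurd h hi⟩
  choose step hstep using hext'
  let word : List ℕ → L := List.foldr (fun i W => step W i) ⟨[a], ha⟩
  have hlen : ∀ l, Admissible l → (word l).1.length = l.length + 1 := by
    intro l
    induction l with
    | nil => intro _; rfl
    | cons i t ih =>
      intro h
      have ht := ih (h.of_suffix (List.suffix_cons i t))
      have := (hstep (word t) i (by rw [ht]; exact h i t List.suffix_rfl)).length
      simp only [List.length_cons, ← ht]
      exact this
  have hchild : ∀ (v : History) i hi,
      IsExtensionAt (word v.1).1 i (word (v.child i hi).1).1 := fun v i hi =>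
    hstep (word v.1) i (by rw [hlen _ v.2]; exact hi)
  -- Square-freeness makes the recorded position the only one at which the child extends its parent.
  have huniq : ∀ (v : History) i hi j, IsExtensionAt (word v.1).1 j (word (v.child i hi).1).1 →
      i = j := fun v i hi j h => (hchild v i hi).position_unique h (hL _ (word _).2)
  let B : BifurcateTree A :=
    { tree := { α := History }
      word := fun v : History => (word v.1).1
      isBifurcate := fun v : History => ⟨hL _ (word v.1).2, fun i hi => by
        obtain ⟨U, hU, h⟩ := hext _ (word v.1).2 i hi
        exact ⟨U, h, hL U hU⟩⟩
      isExtension := fun (v w : History) h => by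
        obtain ⟨i, hi, rfl⟩ := History.covBy_iff.1 h
        exact ⟨i, hchild v i hi⟩
      different_positions := fun (v w w' : History) i h h' hw hw' => by
        obtain ⟨j, hj, rfl⟩ := History.covBy_iff.1 h
        obtain ⟨k, hk, rfl⟩ := History.covBy_iff.1 h'
        obtain rfl := huniq v j hj i hw
        obtain rfl := huniq v k hk j hw'
        rfl }
  refine ⟨B, fun v : History => ?_, rfl, fun (v : History) i hi => ?_⟩
  · refine (History.ncard_covBy v).trans ?_
    exact congrArg (· + 1) (hlen _ v.2).symm
  · have hi' : i ≤ v.1.length + 1 := (hlen _ v.2) ▸ hi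
    refine ⟨v.child i hi', ⟨History.covBy_iff.2 ⟨i, hi', rfl⟩, hchild v i hi'⟩, fun w hw => ?_⟩
    exact B.different_positions v w _ i hw.1 (History.covBy_iff.2 ⟨i, hi', rfl⟩) hw.2
      (hchild v i hi')

end BifurcateWords

theorem theorem2p5 {A : Type*} (hA : Nat.card A = 12) (a : A) :
    ∃ B : BifurcateWords.BifurcateTree A,
      B.IsComplete ∧ B.word ⊥ = [a] ∧
      ∀ v : B.tree, ∀ i ≤ (B.word v).length,
        ∃! w : B.tree, v ⋖ w ∧ BifurcateWords.IsExtensionAt (B.word v) i (B.word w) := by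
  classical
  have : Finite A := Nat.finite_of_card_ne_zero (by omega)
  obtain ⟨e₀⟩ : Nonempty (Option (ZMod 3) × ZMod 3 ≃ A) :=
    Finite.card_eq.1 (by rw [hA]; simp)
  -- The swap makes the letter of level 0 and index 0 print as `a`.
  let e := e₀.trans (Equiv.swap (e₀ (BifurcateWords.letter (0, 0))) a)
  have he : e (BifurcateWords.letter (0, 0)) = a := by simp [e]
  refine BifurcateWords.exists_complete_bifurcateTree
    (L := {W | ∃ D, BifurcateWords.Layered D ∧ W = D.map fun b => e (BifurcateWords.letter b)})
    ?_ ?_ ?_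
  · exact ⟨[(0, 0)], by simp [BifurcateWords.Layered, BifurcateWords.Precedes], by simp [he]⟩
  · rintro _ ⟨D, hD, rfl⟩
    exact hD.squareFree e.injective
  · rintro _ ⟨D, hD, rfl⟩ i hi
    obtain ⟨x, hx⟩ := hD.exists_insert (by simpa using hi)
    exact ⟨_, ⟨_, hx, rfl⟩, hi, e (BifurcateWords.letter x), by simp⟩
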